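/- For functions $f,g$ on the ordered set $[n]=\{1,\dots,n\}$ let $\|f-g\|_1=\sum_{i=1}^n|f(i)-g(i)|$ and, for $2\le k\le n$, let $$\|f-g\|_{\mathcal A_k}=\max_{(I_1,\dots,I_k)}\sum_{i=1}^k|f(I_i)-g(I_i)|,\qquad f(I)=\sum_{j\in I}f(j),$$ where the maximum is over all partitions of $[n]$ into $k$ (nonempty) intervals. There is an absolute constant $c>0$ such that the following holds. Let $n\ge 2$, let $C$ be a set of probability distributions over $[n]$, let $\varepsilon>0$, and let $k=k(C,\varepsilon)$ be the smallest integer with $2\le k\le n$ such that $\|f_1-f_2\|_1\le\|f_1-f_2\|_{\mathcal A_k}+\varepsilon/2$ for all $f_1,f_2\in C$. Then there is an $L_1$ identity testing algorithm for $C$ that uses at most $c\sqrt k/\varepsilon^2$ samples: there are an integer $m\le c\sqrt k/\varepsilon^2$ and a randomized algorithm that, given the explicit description of any $p\in C$ and $m$ independent samples from any unknown $q\in C$, answers YES with probability at least $2/3$ if $q=p$, and answers NO with probability at least $2/3$ if $\|q-p\|_1\ge\varepsilon$. -/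

import Mathlib

/-- The `L₁` distance of two functions on the ordered domain `[n]`. -/
noncomputable def l1Dist {n : ℕ} (f g : Fin n → ℝ) : ℝ :=
  ∑ i, |f i - g i|

/-- The partitions of `[n]` into exactly `k` intervals. The parts of a `Finpartition` are nonempty,
pairwise disjoint and cover `[n]`; an order-connected nonempty subset of `Fin n` is an interval
`[a, b]` with `a ≤ b`. -/
abbrev IntervalPartition (n k : ℕ) : Type :=
  {P : Finpartition (Finset.univ : Finset (Fin n)) //
    P.parts.card = k ∧ ∀ I ∈ P.parts, (I : Set (Fin n)).OrdConnected}

/-- The `A_k`-distance: the maximum, over all partitions of `[n]` into `k` intervals, of the sum of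
the discrepancies `|f(I) - g(I)|` of the parts `I`. There are finitely many such partitions, and
there is at least one if `1 ≤ k ≤ n`, so that the supremum is a maximum. -/
noncomputable def akDist {n : ℕ} (k : ℕ) (f g : Fin n → ℝ) : ℝ :=
  ⨆ P : IntervalPartition n k, ∑ I ∈ P.1.parts, |∑ i ∈ I, f i - ∑ i ∈ I, g i|

/-- A randomized algorithm that is given an explicit function `p` on `[n]` and a sample of `m`
points of `[n]`, and answers YES or NO: `yes p x` is the probability, over the internal randomness
of the algorithm, that it answers YES on the input `p` and the sample `x`. -/
structure RandomizedTester (n m : ℕ) where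
  yes : (Fin n → ℝ) → (Fin m → Fin n) → ℝ
  yes_nonneg : ∀ p x, 0 ≤ yes p x
  yes_le_one : ∀ p x, yes p x ≤ 1

/-- The probability that the tester answers YES on the explicit input `p` and `m` independent
samples from the distribution `q`. -/
noncomputable def RandomizedTester.probYes {n m : ℕ} (T : RandomizedTester n m)
    (p q : Fin n → ℝ) : ℝ :=
  ∑ x : Fin m → Fin n, (∏ j, q (x j)) * T.yes p x

/-- The probability that the tester answers NO on the explicit input `p` and `m` independent
samples from the distribution `q`. -/
noncomputable def RandomizedTester.probNo {n m : ℕ} (T : RandomizedTester n m)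
    (p q : Fin n → ℝ) : ℝ :=
  ∑ x : Fin m → Fin n, (∏ j, q (x j)) * (1 - T.yes p x)

/-- `T` is an `L₁` identity tester for the class `C` with distance parameter `ε`: for every explicit
`p ∈ C` and every unknown `q ∈ C`, with probability at least `2/3` it answers YES if `q = p` and NO
if `‖q - p‖₁ ≥ ε`. -/
def RandomizedTester.IsL1IdentityTester {n m : ℕ} (T : RandomizedTester n m)
    (C : Set (Fin n → ℝ)) (ε : ℝ) : Prop :=
  ∀ p ∈ C, ∀ q ∈ C,
    (q = p → 2 / 3 ≤ T.probYes p q) ∧ (ε ≤ l1Dist q p → 2 / 3 ≤ T.probNo p q)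

/-! The defining property of `k` turns an `L₁` gap of `ε` into an `A_k` gap of `ε / 2`, so it
suffices to test identity to `p` in `A_k`-distance. Since `p` is known, this reduces to uniformity
testing. After mixing with the uniform distribution to get full support, the monotone coupling of
`p` with the uniform distribution on `k * 16 ^ J` grid points is a randomized map
(`exists_staircase_kernel`). It sends `p` exactly to uniform. It also keeps interval structure: a
union of parts of a partition into `k` intervals becomes a set of grid points, up to at most `k`
ambiguous points of total mass at most `16 ^ (-J)`, and this set has at most `k` boundary cells at
every scale (`card_le_of_staircase`, `exists_grid_deficit`).

The grid needs about `k / ε` points, and its size must not enter the sample count. Hence collisions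
are counted at all scales `k * 16 ^ j` at once, with weight `8 ^ (-j)`. A set with few boundary
cells splits into at most `16 * k` cells of each scale, so Cauchy–Schwarz bounds its discrepancy by
the weighted energy (`sq_sum_le_gridEnergy`). The weights decay slowly enough for this bound and
fast enough that the second moment of the kernel under the uniform distribution is `O(k)`,
independent of `J` (`sum_mul_mul_gridKernel_sq_le`).

The kernel is positive semidefinite with mean equal to the energy. Its statistic over pairs from two
half-samples therefore has a variance controlled by the mean and the second moment of the kernel
(`iidExp_crossStat_sub_sq_le`), and Chebyshev's inequality separates energy `0` from energy of order
`ε ^ 2`. -/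

/-- The expectation of `F` over `m` independent samples from `q`. -/
noncomputable def iidExp {α : Type*} [Fintype α] (m : ℕ) (q : α → ℝ) (F : (Fin m → α) → ℝ) : ℝ :=
  ∑ x : Fin m → α, (∏ j, q (x j)) * F x

/-! ### Moments under independent sampling. -/

section IidExp

variable {α β : Type*} [Fintype α] [Fintype β] {m : ℕ} {q : α → ℝ}

theorem iidExp_zero (F : (Fin 0 → α) → ℝ) : iidExp 0 q F = F Fin.elim0 := by
  simp only [iidExp, Finset.univ_unique, Finset.sum_singleton, Finset.univ_eq_empty,
    Finset.prod_empty, one_mul]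
  exact congrArg F (Subsingleton.elim _ _)

theorem iidExp_succ (F : (Fin (m + 1) → α) → ℝ) :
    iidExp (m + 1) q F = ∑ a, q a * iidExp m q (fun x => F (Fin.cons a x)) := by
  simp only [iidExp]
  rw [← (Fin.consEquiv (fun _ : Fin (m + 1) => α)).sum_comp, Fintype.sum_prod_type]
  refine Finset.sum_congr rfl fun a _ => ?_
  rw [Finset.mul_sum]
  refine Finset.sum_congr rfl fun x _ => ?_
  simp [Fin.consEquiv, Fin.prod_univ_succ, mul_assoc]

theorem iidExp_add (F G : (Fin m → α) → ℝ) :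
    iidExp m q (fun x => F x + G x) = iidExp m q F + iidExp m q G := by
  simp [iidExp, mul_add, Finset.sum_add_distrib]

theorem iidExp_const_mul (c : ℝ) (F : (Fin m → α) → ℝ) :
    iidExp m q (fun x => c * F x) = c * iidExp m q F := by
  simp only [iidExp, Finset.mul_sum]
  exact Finset.sum_congr rfl fun x _ => by ring

theorem iidExp_sum {ι : Type*} (s : Finset ι) (F : ι → (Fin m → α) → ℝ) :
    iidExp m q (fun x => ∑ i ∈ s, F i x) = ∑ i ∈ s, iidExp m q (F i) := by
  simp only [iidExp, Finset.mul_sum]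
  exact Finset.sum_comm

theorem iidExp_mono (hq : ∀ a, 0 ≤ q a) {F G : (Fin m → α) → ℝ} (h : ∀ x, F x ≤ G x) :
    iidExp m q F ≤ iidExp m q G :=
  Finset.sum_le_sum fun x _ =>
    mul_le_mul_of_nonneg_left (h x) (Finset.prod_nonneg fun _ _ => hq _)

theorem iidExp_const (hq1 : ∑ a, q a = 1) (c : ℝ) : iidExp m q (fun _ => c) = c := by
  induction m with
  | zero => simp [iidExp_zero]
  | succ m ih => simp [iidExp_succ, ih, ← Finset.sum_mul, hq1]

theorem iidExp_sum_apply (hq1 : ∑ a, q a = 1) (f : α → ℝ) :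
    iidExp m q (fun x => ∑ t, f (x t)) = m * ∑ a, q a * f a := by
  induction m with
  | zero => simp [iidExp_zero]
  | succ m ih =>
    simp only [iidExp_succ, Fin.sum_univ_succ, Fin.cons_zero, Fin.cons_succ, iidExp_add,
      iidExp_const hq1, ih, mul_add, Finset.sum_add_distrib, ← Finset.sum_mul, hq1]
    push_cast
    ring

theorem iidExp_sum_apply_sq (hq1 : ∑ a, q a = 1) (f : α → ℝ) :
    iidExp m q (fun x => (∑ t, f (x t)) ^ 2) =
      m * ∑ a, q a * f a ^ 2 + m * (m - 1) * (∑ a, q a * f a) ^ 2 := by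
  induction m with
  | zero => simp [iidExp_zero]
  | succ m ih =>
    have key : ∀ a, iidExp m q (fun x => (f a + ∑ t, f (x t)) ^ 2) =
        f a ^ 2 + 2 * f a * (m * ∑ a, q a * f a) +
          (m * ∑ a, q a * f a ^ 2 + m * (m - 1) * (∑ a, q a * f a) ^ 2) := fun a => by
      rw [← ih, ← iidExp_sum_apply hq1 f]
      simp only [add_sq, iidExp_add, iidExp_const hq1, iidExp_const_mul]
    simp only [iidExp_succ, Fin.sum_univ_succ, Fin.cons_zero, Fin.cons_succ, key]
    have e : ∀ a, q a * (f a ^ 2 + 2 * f a * (m * ∑ a, q a * f a) +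
          (m * ∑ a, q a * f a ^ 2 + m * (m - 1) * (∑ a, q a * f a) ^ 2)) =
        q a * f a ^ 2 + (q a * f a) * (2 * (m * ∑ a, q a * f a)) +
          q a * (m * ∑ a, q a * f a ^ 2 + m * (m - 1) * (∑ a, q a * f a) ^ 2) :=
      fun a => by ring
    simp only [e, Finset.sum_add_distrib, ← Finset.sum_mul, hq1]
    push_cast
    ring

theorem iidExp_append {l : ℕ} (F : (Fin (l + m) → α) → ℝ) :
    iidExp (l + m) q F = iidExp l q fun x => iidExp m q fun y => F (Fin.append x y) := by
  simp only [iidExp]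
  rw [← (Fin.appendEquiv l m).sum_comp, Fintype.sum_prod_type]
  refine Finset.sum_congr rfl fun x _ => ?_
  rw [Finset.mul_sum]
  refine Finset.sum_congr rfl fun y _ => ?_
  simp [Fin.appendEquiv, Fin.prod_univ_add, mul_assoc]

/-- Passing every sample through the kernel `κ`. -/
theorem iidExp_kernel (κ : α → β → ℝ) (F : (Fin m → β) → ℝ) :
    iidExp m q (fun x => ∑ y : Fin m → β, (∏ j, κ (x j) (y j)) * F y) =
      iidExp m (fun b => ∑ a, q a * κ a b) F := by
  simp only [iidExp, Finset.mul_sum]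
  rw [Finset.sum_comm]
  refine Finset.sum_congr rfl fun y _ => ?_
  rw [Finset.prod_univ_sum, Fintype.piFinset_univ, Finset.sum_mul]
  refine Finset.sum_congr rfl fun x _ => ?_
  rw [Finset.prod_mul_distrib, mul_assoc]

end IidExp

theorem sum_prod_kernel {α β : Type*} [Fintype β] {m : ℕ} {κ : α → β → ℝ} (hκ : ∀ a, ∑ b, κ a b = 1) (x : Fin m → α) :
    ∑ y : Fin m → β, ∏ j, κ (x j) (y j) = 1 := by
  have := Finset.prod_univ_sum (fun _ : Fin m => (Finset.univ : Finset β)) fun j b => κ (x j) b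
  rw [Fintype.piFinset_univ] at this
  rw [← this]
  simp [hκ]

/-! ### Mean and variance of the two-sample statistic of a positive semidefinite kernel. -/

/-- The two-sample statistic of the kernel `h`: the sum of `h` over the pairs formed by a point of
the first half and a point of the second half of the sample. -/
def crossStat {α : Type*} {m : ℕ} (h : α → α → ℝ) (x : Fin (m + m) → α) : ℝ :=
  ∑ t, ∑ s, h (x (Fin.castAdd m s)) (x (Fin.natAdd m t))

theorem crossStat_append {α : Type*} {m : ℕ} (h : α → α → ℝ) (x y : Fin m → α) :
    crossStat h (Fin.append x y) = ∑ t, ∑ s, h (x s) (y t) := by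
  simp only [crossStat, Fin.append_left, Fin.append_right]

section TwoSample

variable {α ι : Type*} [Fintype α] {m : ℕ} {q : α → ℝ}

theorem iidExp_crossStat (hq1 : ∑ a, q a = 1) (h : α → α → ℝ) :
    iidExp (m + m) q (crossStat h) = (m : ℝ) ^ 2 * ∑ a, ∑ b, q a * q b * h a b := by
  rw [iidExp_append]
  simp only [crossStat_append]
  have e : ∀ x : Fin m → α, iidExp m q (fun y => ∑ t, ∑ s, h (x s) (y t)) =
      m * ∑ s, ∑ b, q b * h (x s) b := fun x => by
    rw [iidExp_sum_apply hq1 fun b => ∑ s, h (x s) b]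
    simp only [Finset.mul_sum]
    rw [Finset.sum_comm]
  simp only [e, iidExp_const_mul]
  rw [iidExp_sum_apply hq1 fun a => ∑ b, q b * h a b]
  simp only [Finset.mul_sum]
  exact Finset.sum_congr rfl fun a _ => Finset.sum_congr rfl fun b _ => by ring

theorem iidExp_crossStat_sq (hq1 : ∑ a, q a = 1) {h : α → α → ℝ} (hs : ∀ a b, h a b = h b a) :
    iidExp (m + m) q (fun x => crossStat h x ^ 2) =
      (m : ℝ) ^ 2 * ∑ a, ∑ b, q a * q b * h a b ^ 2 +
        2 * (m : ℝ) ^ 2 * (m - 1) * ∑ a, q a * (∑ b, q b * h a b) ^ 2 +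
        (m : ℝ) ^ 2 * (m - 1) ^ 2 * (∑ a, ∑ b, q a * q b * h a b) ^ 2 := by
  rw [iidExp_append]
  simp only [crossStat_append]
  have e : ∀ x : Fin m → α, iidExp m q (fun y => (∑ t, ∑ s, h (x s) (y t)) ^ 2) =
      m * ∑ b, q b * (∑ s, h (x s) b) ^ 2 +
        m * (m - 1) * (∑ s, ∑ b, q b * h (x s) b) ^ 2 := fun x => by
    rw [iidExp_sum_apply_sq hq1 fun b => ∑ s, h (x s) b]
    simp only [Finset.mul_sum]
    rw [Finset.sum_comm (s := Finset.univ (α := Fin m))]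
  simp only [e, iidExp_add, iidExp_const_mul, iidExp_sum]
  rw [iidExp_sum_apply_sq hq1 fun a => ∑ b, q b * h a b]
  have e2 : ∀ b, iidExp m q (fun x => (∑ s, h (x s) b) ^ 2) =
      m * ∑ a, q a * h a b ^ 2 + m * (m - 1) * (∑ a, q a * h b a) ^ 2 := fun b => by
    rw [iidExp_sum_apply_sq hq1 fun a => h a b]
    simp only [hs _ b]
  simp only [e2, mul_add, Finset.sum_add_distrib]
  have e3 : ∑ b, q b * (m * ∑ a, q a * h a b ^ 2) =
      m * ∑ a, ∑ b, q a * q b * h a b ^ 2 := by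
    simp only [Finset.mul_sum]
    rw [Finset.sum_comm]
    exact Finset.sum_congr rfl fun a _ => Finset.sum_congr rfl fun b _ => by ring
  have e4 : ∑ b, q b * (m * (m - 1) * (∑ a, q a * h b a) ^ 2) =
      m * (m - 1) * ∑ a, q a * (∑ b, q b * h a b) ^ 2 := by
    rw [Finset.mul_sum]
    exact Finset.sum_congr rfl fun a _ => by ring
  have e5 : ∑ a, q a * ∑ b, q b * h a b = ∑ a, ∑ b, q a * q b * h a b := by
    simp only [Finset.mul_sum, mul_assoc]
  rw [e3, e4, e5]
  ring

theorem sum_mul_mul_kernel (I : Finset ι) {c : ι → ℝ} (φ : ι → α → ℝ) {h : α → α → ℝ}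
    (hh : ∀ a b, h a b = ∑ i ∈ I, c i * (φ i a * φ i b)) (f g : α → ℝ) :
    ∑ a, ∑ b, f a * g b * h a b =
      ∑ i ∈ I, c i * ((∑ a, f a * φ i a) * ∑ b, g b * φ i b) := by
  simp only [hh, Finset.sum_mul_sum]
  simp only [Finset.mul_sum]
  rw [Finset.sum_comm (s := I)]
  refine Finset.sum_congr rfl fun a _ => ?_
  rw [Finset.sum_comm (s := I)]
  exact Finset.sum_congr rfl fun b _ => Finset.sum_congr rfl fun i _ => by ring

/-- For a positive semidefinite kernel, the second moment of the projection is controlled by the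
mean and by the second moment of the kernel. -/
theorem sum_sq_projection_le (hq : ∀ a, 0 ≤ q a) (I : Finset ι) {c : ι → ℝ}
    (hc : ∀ i ∈ I, 0 ≤ c i) (φ : ι → α → ℝ) {h : α → α → ℝ}
    (hh : ∀ a b, h a b = ∑ i ∈ I, c i * (φ i a * φ i b)) {A : ℝ} (hA : 0 ≤ A)
    (hA2 : ∑ a, ∑ b, q a * q b * h a b ^ 2 ≤ A ^ 2) :
    ∑ a, q a * (∑ b, q b * h a b) ^ 2 ≤ A * ∑ a, ∑ b, q a * q b * h a b := by
  have bil := sum_mul_mul_kernel I φ hh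
  have hs : ∀ a b, h a b = h b a := fun a b => by simp only [hh, mul_comm]
  set g : α → ℝ := fun a => ∑ b, q b * h a b with hg
  set θ := ∑ a, ∑ b, q a * q b * h a b with hθ
  set S := ∑ a, q a * g a ^ 2 with hS
  set T := ∑ a, ∑ b, (q a * g a) * (q b * g b) * h a b with hT
  have hS0 : 0 ≤ S := Finset.sum_nonneg fun a _ => mul_nonneg (hq a) (sq_nonneg _)
  have hθ0 : 0 ≤ θ := by
    rw [hθ, bil q q]
    exact Finset.sum_nonneg fun i hi => mul_nonneg (hc i hi) (mul_self_nonneg _)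
  -- Cauchy–Schwarz for the form of `h`: `S` is its value at `(q, q * g)`, while `θ` and `T` are its
  -- values on the diagonal at `q` and `q * g`.
  have h1 : S ^ 2 ≤ θ * T := by
    have e : S = ∑ i ∈ I, c i * ((∑ a, q a * φ i a) * ∑ b, (q b * g b) * φ i b) := by
      rw [← bil q fun b => q b * g b, Finset.sum_comm, hS]
      refine Finset.sum_congr rfl fun b _ => ?_
      rw [sq, ← mul_assoc]
      rw [show g b = ∑ a, q a * h b a from rfl, Finset.mul_sum]
      exact Finset.sum_congr rfl fun a _ => by rw [hs b a]; ring
    rw [e, hθ, hT, bil q q, bil]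
    refine Finset.sum_sq_le_sum_mul_sum_of_sq_le_mul I ?_ ?_ ?_
    · exact fun i hi => mul_nonneg (hc i hi) (mul_self_nonneg _)
    · exact fun i hi => mul_nonneg (hc i hi) (mul_self_nonneg _)
    · intro i _
      exact le_of_eq (by ring)
  -- Cauchy–Schwarz on pairs weighted by `q ⊗ q`, separating `g a * g b` from `h a b`.
  have h2 : T ^ 2 ≤ S ^ 2 * A ^ 2 := by
    have e : S ^ 2 = ∑ p : α × α, q p.1 * q p.2 * (g p.1 * g p.2) ^ 2 := by
      rw [sq, hS, Finset.sum_mul_sum, Fintype.sum_prod_type]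
      exact Finset.sum_congr rfl fun a _ => Finset.sum_congr rfl fun b _ => by ring
    have e' : T = ∑ p : α × α, q p.1 * q p.2 * (g p.1 * g p.2) * h p.1 p.2 := by
      rw [hT, Fintype.sum_prod_type]
      exact Finset.sum_congr rfl fun a _ => Finset.sum_congr rfl fun b _ => by ring
    refine le_trans ?_ (mul_le_mul_of_nonneg_left hA2 (sq_nonneg S))
    rw [e, e', ← Fintype.sum_prod_type' (fun a b => q a * q b * h a b ^ 2)]
    refine Finset.sum_sq_le_sum_mul_sum_of_sq_le_mul _ ?_ ?_ ?_
    · exact fun p _ => mul_nonneg (mul_nonneg (hq _) (hq _)) (sq_nonneg _)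
    · exact fun p _ => mul_nonneg (mul_nonneg (hq _) (hq _)) (sq_nonneg _)
    · intro i _
      exact le_of_eq (by ring)
  have h3 : T ≤ S * A := by
    refine abs_le_of_sq_le_sq' (a := T) (b := S * A) ?_ (by positivity) |>.2
    rwa [mul_pow]
  rcases hS0.eq_or_lt with h0 | h0
  · rw [← h0]; positivity
  · have : S * S ≤ S * (A * θ) := by nlinarith
    exact le_of_mul_le_mul_left this h0

/-- Disjoint pairs contribute at most the squared mean and cancel. Identical pairs give the `A ^ 2`
term, and pairs sharing one sample are bounded through `sum_sq_projection_le`. -/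
theorem iidExp_crossStat_sub_sq_le (hq : ∀ a, 0 ≤ q a) (hq1 : ∑ a, q a = 1) (I : Finset ι)
    {c : ι → ℝ} (hc : ∀ i ∈ I, 0 ≤ c i) (φ : ι → α → ℝ) {h : α → α → ℝ}
    (hh : ∀ a b, h a b = ∑ i ∈ I, c i * (φ i a * φ i b)) {A : ℝ} (hA : 0 ≤ A)
    (hA2 : ∑ a, ∑ b, q a * q b * h a b ^ 2 ≤ A ^ 2) {θ : ℝ}
    (hθ : ∑ a, ∑ b, q a * q b * h a b = θ) :
    iidExp (m + m) q (fun x => (crossStat h x - (m : ℝ) ^ 2 * θ) ^ 2) ≤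
      (m : ℝ) ^ 2 * A ^ 2 + 2 * (m : ℝ) ^ 3 * (A * θ) := by
  have hs : ∀ a b, h a b = h b a := fun a b => by simp only [hh, mul_comm]
  have hS := sum_sq_projection_le hq I hc φ hh hA hA2
  have hS0 : 0 ≤ ∑ a, q a * (∑ b, q b * h a b) ^ 2 :=
    Finset.sum_nonneg fun a _ => mul_nonneg (hq a) (sq_nonneg _)
  have e : ∀ x : Fin (m + m) → α, (crossStat h x - (m : ℝ) ^ 2 * θ) ^ 2 =
      crossStat h x ^ 2 + ((-2 * ((m : ℝ) ^ 2 * θ)) * crossStat h x + ((m : ℝ) ^ 2 * θ) ^ 2) :=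
    fun x => by ring
  simp only [e, iidExp_add, iidExp_const_mul, iidExp_const hq1, iidExp_crossStat hq1,
    iidExp_crossStat_sq hq1 hs, hθ] at hS ⊢
  generalize ∑ a, q a * (∑ b, q b * h a b) ^ 2 = S at hS hS0
  have hm : (0 : ℝ) ≤ m := Nat.cast_nonneg m
  have h1 : (m : ℝ) ^ 2 * ∑ a, ∑ b, q a * q b * h a b ^ 2 ≤ (m : ℝ) ^ 2 * A ^ 2 := by gcongr
  have h2 : 2 * (m : ℝ) ^ 2 * (m - 1) * S ≤ 2 * (m : ℝ) ^ 3 * (A * θ) := by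
    calc 2 * (m : ℝ) ^ 2 * (m - 1) * S ≤ 2 * (m : ℝ) ^ 3 * S := by
          have : 0 ≤ 2 * (m : ℝ) ^ 2 * S := by positivity
          nlinarith
      _ ≤ _ := by gcongr
  have h3 : (m : ℝ) ^ 2 * (m - 1) ^ 2 * θ ^ 2 ≤ (m : ℝ) ^ 4 * θ ^ 2 := by
    -- For `m = 0` the comparison of `(m - 1) ^ 2` with `m ^ 2` fails, but the outer factor
    -- vanishes.
    rcases Nat.eq_zero_or_pos m with rfl | h0
    · simp
    · have : (1 : ℝ) ≤ m := by exact_mod_cast h0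
      have : ((m : ℝ) - 1) ^ 2 ≤ (m : ℝ) ^ 2 := by
        apply pow_le_pow_left₀ <;> linarith
      calc (m : ℝ) ^ 2 * (m - 1) ^ 2 * θ ^ 2 ≤ (m : ℝ) ^ 2 * (m : ℝ) ^ 2 * θ ^ 2 := by gcongr
        _ = _ := by ring
  linarith

/-- Chebyshev's inequality for a finite sample. -/
theorem iidExp_indicator_le (hq : ∀ a, 0 ≤ q a) {Z : (Fin m → α) → ℝ} {μ r V : ℝ} (hr : 0 < r)
    (hV : iidExp m q (fun x => (Z x - μ) ^ 2) ≤ V) (P : (Fin m → α) → Prop) [DecidablePred P]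
    (hP : ∀ x, P x → r ≤ |Z x - μ|) :
    iidExp m q (fun x => if P x then 1 else 0) ≤ V / r ^ 2 := by
  rw [le_div_iff₀ (by positivity), mul_comm, ← iidExp_const_mul]
  refine le_trans (iidExp_mono hq fun x => ?_) hV
  split_ifs with h
  · rw [mul_one, ← sq_abs (Z x - μ)]
    exact pow_le_pow_left₀ hr.le (hP x h) 2
  · rw [mul_zero]
    exact sq_nonneg _

end TwoSample

/-! ### Nested grids and the multiscale energy. -/

/-- The cell of the point `y` in the partition of `[k * 16 ^ J]` into `k * 16 ^ j` intervals of equal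
length. -/
def gridCell (J j y : ℕ) : ℕ := y / 16 ^ (J - j)

theorem gridCell_self (J y : ℕ) : gridCell J J y = y := by simp [gridCell]

theorem gridCell_lt {k J j y : ℕ} (hj : j ≤ J) (hy : y < k * 16 ^ J) :
    gridCell J j y < k * 16 ^ j := by
  rw [gridCell, Nat.div_lt_iff_lt_mul (by positivity), mul_assoc, ← pow_add,
    Nat.add_sub_cancel' hj]
  exact hy

theorem gridCell_succ_div {J j : ℕ} (hj : j < J) (y : ℕ) :
    gridCell J (j + 1) y / 16 = gridCell J j y := by
  rw [gridCell, gridCell, Nat.div_div_eq_div_mul, ← pow_succ]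
  congr 2
  omega

theorem gridCell_eq_iff {J j y b : ℕ} :
    gridCell J j y = b ↔ b * 16 ^ (J - j) ≤ y ∧ y < b * 16 ^ (J - j) + 16 ^ (J - j) := by
  have hD : 0 < 16 ^ (J - j) := by positivity
  rw [gridCell, ← Nat.succ_mul, ← Nat.le_div_iff_mul_le hD, ← Nat.div_lt_iff_lt_mul hD]
  omega

theorem card_gridCell_eq {k J j b : ℕ} (hj : j ≤ J) (hb : b < k * 16 ^ j) :
    (Finset.univ.filter fun y : Fin (k * 16 ^ J) => gridCell J j y = b).card = 16 ^ (J - j) := by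
  have hL : k * 16 ^ J = k * 16 ^ j * 16 ^ (J - j) := by
    rw [mul_assoc, ← pow_add, Nat.add_sub_cancel' hj]
  simp only [gridCell_eq_iff]
  refine Eq.trans ?_ (Finset.card_range (16 ^ (J - j)))
  refine Finset.card_bij (fun y _ => (y : ℕ) - b * 16 ^ (J - j)) ?_ ?_ ?_
  · intro y hy
    have := (Finset.mem_filter.1 hy).2
    rw [Finset.mem_range]
    omega
  · intro y hy z hz h
    have h1 := (Finset.mem_filter.1 hy).2
    have h2 := (Finset.mem_filter.1 hz).2
    exact Fin.ext (by omega)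
  · intro i hi
    rw [Finset.mem_range] at hi
    refine ⟨⟨b * 16 ^ (J - j) + i, by rw [hL]; nlinarith⟩, ?_, by simp⟩
    simpa using hi

/-- The sum of `f` over the cell `b` of the `j`-th grid. -/
noncomputable def gridSum {k J : ℕ} (j : ℕ) (f : Fin (k * 16 ^ J) → ℝ) (b : ℕ) : ℝ :=
  ∑ y ∈ Finset.univ.filter (fun y : Fin (k * 16 ^ J) => gridCell J j y = b), f y

/-- The discounted sum over all grids of the `χ²`-energies of `d`. -/
noncomputable def gridEnergy {k J : ℕ} (d : Fin (k * 16 ^ J) → ℝ) : ℝ :=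
  ∑ j ∈ Finset.range (J + 1), (1 / 8 : ℝ) ^ j * (k * 16 ^ j) *
    ∑ b ∈ Finset.range (k * 16 ^ j), gridSum j d b ^ 2

/-- The multiscale collision kernel. -/
noncomputable def gridKernel (k J : ℕ) (x y : Fin (k * 16 ^ J)) : ℝ :=
  ∑ j ∈ Finset.range (J + 1), (1 / 8 : ℝ) ^ j *
    (k * 16 ^ j * (if gridCell J j x = gridCell J j y then 1 else 0) - 1)

/-- The centered indicator function of the cell `i.2` of the grid `i.1`. -/
noncomputable def gridFeature (k J : ℕ) (i : Σ _ : ℕ, ℕ) (x : Fin (k * 16 ^ J)) : ℝ :=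
  (if gridCell J i.1 x = i.2 then 1 else 0) - 1 / (k * 16 ^ i.1)

section Grid

variable {k J : ℕ}

theorem sum_gridSum {j : ℕ} (hj : j ≤ J) (f : Fin (k * 16 ^ J) → ℝ) :
    ∑ b ∈ Finset.range (k * 16 ^ j), gridSum j f b = ∑ y, f y :=
  Finset.sum_fiberwise_of_maps_to (fun y _ => Finset.mem_range.2 (gridCell_lt hj y.2)) f

theorem gridSum_sub_uniform (hk : 0 < k) {j b : ℕ} (hj : j ≤ J) (hb : b < k * 16 ^ j)
    (q : Fin (k * 16 ^ J) → ℝ) :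
    gridSum j (fun y => q y - 1 / (k * 16 ^ J)) b = gridSum j q b - 1 / (k * 16 ^ j) := by
  have hk' : (0 : ℝ) < k := by exact_mod_cast hk
  have e : (16 : ℝ) ^ J = 16 ^ (J - j) * 16 ^ j := by rw [← pow_add, Nat.sub_add_cancel hj]
  simp only [gridSum, Finset.sum_sub_distrib, Finset.sum_const, card_gridCell_eq hj hb,
    nsmul_eq_mul]
  rw [e]
  push_cast
  field_simp

/-- With `N` cells, centering each indicator by `1 / N` turns `N * 1[same cell]` into `N * 1[same
cell] - 1`. The nonnegative coefficients exhibit the kernel as positive semidefinite. -/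
theorem gridKernel_eq_sum (hk : 0 < k) (x y : Fin (k * 16 ^ J)) :
    gridKernel k J x y =
      ∑ i ∈ (Finset.range (J + 1)).sigma fun j => Finset.range (k * 16 ^ j),
        ((1 / 8 : ℝ) ^ i.1 * (k * 16 ^ i.1)) * (gridFeature k J i x * gridFeature k J i y) := by
  have hk' : (0 : ℝ) < k := by exact_mod_cast hk
  rw [Finset.sum_sigma, gridKernel]
  refine Finset.sum_congr rfl fun j hj => ?_
  have hj' : j ≤ J := Nat.lt_succ_iff.1 (Finset.mem_range.1 hj)
  have hx := Finset.mem_range.2 (gridCell_lt hj' x.2)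
  have hy := Finset.mem_range.2 (gridCell_lt hj' y.2)
  have h16 : (0 : ℝ) < k * 16 ^ j := by positivity
  dsimp only
  rw [← Finset.mul_sum, mul_assoc ((1 / 8 : ℝ) ^ j)]
  congr 1
  simp only [gridFeature, sub_mul, mul_sub, Finset.sum_sub_distrib, ← Finset.mul_sum,
    Finset.sum_const, Finset.card_range, nsmul_eq_mul, ite_mul, mul_ite,
    mul_one, mul_zero, one_mul, zero_mul, Finset.sum_ite_eq, hx, hy, if_true]
  by_cases h : gridCell J j x = gridCell J j y
  · simp only [h, if_true]
    push_cast
    field_simp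
    ring
  · simp only [h, if_false]
    push_cast
    field_simp
    ring

theorem sum_mul_gridFeature (hk : 0 < k) {q : Fin (k * 16 ^ J) → ℝ} (hq1 : ∑ a, q a = 1)
    {j b : ℕ} (hj : j ≤ J) (hb : b < k * 16 ^ j) :
    ∑ a, q a * gridFeature k J ⟨j, b⟩ a = gridSum j (fun y => q y - 1 / (k * 16 ^ J)) b := by
  rw [gridSum_sub_uniform hk hj hb]
  simp only [gridFeature, mul_sub, Finset.sum_sub_distrib, ← Finset.sum_mul, hq1, one_mul,
    mul_ite, mul_one, mul_zero, gridSum, Finset.sum_filter]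

theorem sum_mul_mul_gridKernel (hk : 0 < k) {q : Fin (k * 16 ^ J) → ℝ} (hq1 : ∑ a, q a = 1) :
    ∑ a, ∑ b, q a * q b * gridKernel k J a b =
      gridEnergy fun y => q y - 1 / (k * 16 ^ J) := by
  rw [sum_mul_mul_kernel _ _ (gridKernel_eq_sum hk) q q, Finset.sum_sigma, gridEnergy]
  refine Finset.sum_congr rfl fun j hj => ?_
  rw [Finset.mul_sum]
  refine Finset.sum_congr rfl fun b hb => ?_
  rw [sum_mul_gridFeature hk hq1 (Nat.lt_succ_iff.1 (Finset.mem_range.1 hj))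
    (Finset.mem_range.1 hb), sq]

theorem sum_collision {j : ℕ} (hj : j ≤ J) (q : Fin (k * 16 ^ J) → ℝ) :
    ∑ a, ∑ b, q a * q b * (if gridCell J j a = gridCell J j b then 1 else 0) =
      ∑ b ∈ Finset.range (k * 16 ^ j), gridSum j q b ^ 2 := by
  have e : ∀ a, ∑ b, q a * q b * (if gridCell J j a = gridCell J j b then 1 else 0) =
      q a * gridSum j q (gridCell J j a) := fun a => by
    simp only [gridSum, Finset.sum_filter, Finset.mul_sum, mul_ite, mul_one, mul_zero]
    exact Finset.sum_congr rfl fun b _ => by simp only [eq_comm]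
  simp only [e]
  rw [← sum_gridSum hj]
  refine Finset.sum_congr rfl fun b _ => ?_
  rw [sq]
  conv_rhs => rw [gridSum, Finset.sum_mul]
  refine Finset.sum_congr rfl fun y hy => ?_
  dsimp only
  rw [(Finset.mem_filter.1 hy).2, gridSum]

theorem sum_gridSum_sq (hk : 0 < k) {q : Fin (k * 16 ^ J) → ℝ} (hq1 : ∑ a, q a = 1)
    {j : ℕ} (hj : j ≤ J) :
    (k * 16 ^ j) * ∑ b ∈ Finset.range (k * 16 ^ j), gridSum j q b ^ 2 =
      1 + (k * 16 ^ j) * ∑ b ∈ Finset.range (k * 16 ^ j),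
        gridSum j (fun y => q y - 1 / (k * 16 ^ J)) b ^ 2 := by
  have hk' : (0 : ℝ) < k := by exact_mod_cast hk
  have h16 : (0 : ℝ) < k * 16 ^ j := by positivity
  have e : ∑ b ∈ Finset.range (k * 16 ^ j),
        gridSum j (fun y => q y - 1 / (k * 16 ^ J)) b ^ 2 =
      ∑ b ∈ Finset.range (k * 16 ^ j), gridSum j q b ^ 2 - 1 / (k * 16 ^ j) := by
    rw [Finset.sum_congr rfl fun b hb => by
      rw [gridSum_sub_uniform hk hj (Finset.mem_range.1 hb), sub_sq]]
    simp only [Finset.sum_sub_distrib, Finset.sum_add_distrib, ← Finset.sum_mul,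
      ← Finset.mul_sum, sum_gridSum hj, hq1, Finset.sum_const, Finset.card_range, nsmul_eq_mul]
    push_cast
    field_simp
    ring
  rw [e, mul_sub, mul_one_div_cancel h16.ne']
  ring

/-- Splitting the squared weights as `64 ^ (-j) = 2 ^ (-j) * 32 ^ (-j)` reduces to single scales,
where `k * 16 ^ j` cells cost `k * 16 ^ j * (1 + E j)`. The factor `32 ^ (-j)` leaves a convergent
series for the constant part. The energy part loses at most `4 ^ J` against the weights `8 ^ (-j)`.
-/
theorem sum_mul_mul_gridKernel_sq_le (hk : 0 < k) {q : Fin (k * 16 ^ J) → ℝ}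
    (hq : ∀ a, 0 ≤ q a) (hq1 : ∑ a, q a = 1) :
    ∑ a, ∑ b, q a * q b * gridKernel k J a b ^ 2 ≤
      4 * k + 2 * k * 4 ^ J * gridEnergy fun y => q y - 1 / (k * 16 ^ J) := by
  have hk' : (0 : ℝ) < k := by exact_mod_cast hk
  set E : ℕ → ℝ := fun j => (k * 16 ^ j) * ∑ b ∈ Finset.range (k * 16 ^ j),
        gridSum j (fun y => q y - 1 / (k * 16 ^ J)) b ^ 2 with hE
  have hE0 : ∀ j, 0 ≤ E j := fun j =>
    mul_nonneg (by positivity) (Finset.sum_nonneg fun _ _ => sq_nonneg _)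
  have geom : ∀ n, ∑ j ∈ Finset.range n, (1 / 2 : ℝ) ^ j ≤ 2 := fun n => sum_geometric_two_le n
  have hpt : ∀ a b, gridKernel k J a b ^ 2 ≤ 2 * ∑ j ∈ Finset.range (J + 1), (1 / 32 : ℝ) ^ j *
      (k * 16 ^ j * (if gridCell J j a = gridCell J j b then 1 else 0) - 1) ^ 2 := fun a b => by
    refine le_trans (Finset.sum_sq_le_sum_mul_sum_of_sq_le_mul _ (f := fun j => (1 / 2 : ℝ) ^ j)
      (g := fun j => (1 / 32 : ℝ) ^ j *
        (k * 16 ^ j * (if gridCell J j a = gridCell J j b then 1 else 0) - 1) ^ 2)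
      (fun j _ => by positivity) (fun j _ => by positivity) fun j _ => ?_) ?_
    · have e : ((1 / 8 : ℝ) ^ j) ^ 2 = (1 / 2) ^ j * (1 / 32) ^ j := by
        rw [← mul_pow, ← pow_mul, mul_comm j 2, pow_mul]
        norm_num
      rw [mul_pow ((1 / 8 : ℝ) ^ j), e, mul_assoc]
    · exact mul_le_mul_of_nonneg_right (geom _) (Finset.sum_nonneg fun j _ => by positivity)
  have hlev : ∀ j ∈ Finset.range (J + 1), ∑ a, ∑ b, q a * q b *
      (k * 16 ^ j * (if gridCell J j a = gridCell J j b then 1 else 0) - 1) ^ 2 ≤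
        k * 16 ^ j * (1 + E j) := fun j hj => by
    have hj' : j ≤ J := Nat.lt_succ_iff.1 (Finset.mem_range.1 hj)
    -- The indicator is idempotent, so only the collision probability enters.
    have e : ∀ a b, q a * q b *
        (k * 16 ^ j * (if gridCell J j a = gridCell J j b then 1 else 0) - 1) ^ 2 =
        ((k * 16 ^ j) ^ 2 - 2 * (k * 16 ^ j)) *
          (q a * q b * (if gridCell J j a = gridCell J j b then 1 else 0)) + q a * q b :=
      fun a b => by split_ifs <;> ring
    simp only [e, Finset.sum_add_distrib, ← Finset.mul_sum, hq1,
      sum_collision hj', mul_one]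
    have := sum_gridSum_sq hk hq1 hj'
    rw [sub_mul, sq, mul_assoc, mul_assoc, this]
    have h0 := hE0 j
    simp only [hE] at h0 ⊢
    linarith
  calc ∑ a, ∑ b, q a * q b * gridKernel k J a b ^ 2
      ≤ ∑ a, ∑ b, q a * q b * (2 * ∑ j ∈ Finset.range (J + 1), (1 / 32 : ℝ) ^ j *
      (k * 16 ^ j * (if gridCell J j a = gridCell J j b then 1 else 0) - 1) ^ 2) :=
        Finset.sum_le_sum fun a _ => Finset.sum_le_sum fun b _ =>
          mul_le_mul_of_nonneg_left (hpt a b) (mul_nonneg (hq a) (hq b))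
    _ = 2 * ∑ j ∈ Finset.range (J + 1), (1 / 32 : ℝ) ^ j * ∑ a, ∑ b, q a * q b *
      (k * 16 ^ j * (if gridCell J j a = gridCell J j b then 1 else 0) - 1) ^ 2 := by
        simp only [Finset.mul_sum]
        rw [Finset.sum_comm (s := Finset.range (J + 1))]
        refine Finset.sum_congr rfl fun a _ => ?_
        rw [Finset.sum_comm (s := Finset.range (J + 1))]
        exact Finset.sum_congr rfl fun b _ => Finset.sum_congr rfl fun j _ => by ring
    _ ≤ 2 * ∑ j ∈ Finset.range (J + 1),
          (k * (1 / 2 : ℝ) ^ j + k * 4 ^ J * ((1 / 8 : ℝ) ^ j * E j)) := by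
        refine mul_le_mul_of_nonneg_left (Finset.sum_le_sum fun j hj => ?_) zero_le_two
        refine (mul_le_mul_of_nonneg_left (hlev j hj) (by positivity)).trans ?_
        have h4 : (4 : ℝ) ^ j ≤ 4 ^ J :=
          pow_le_pow_right₀ (by norm_num) (Nat.lt_succ_iff.1 (Finset.mem_range.1 hj))
        have e1 : (1 / 32 : ℝ) ^ j * 16 ^ j = (1 / 2) ^ j := by rw [← mul_pow]; norm_num
        have e2 : (1 / 2 : ℝ) ^ j = 4 ^ j * (1 / 8) ^ j := by rw [← mul_pow]; norm_num
        have : (1 / 32 : ℝ) ^ j * (k * 16 ^ j * (1 + E j)) =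
            k * (1 / 2 : ℝ) ^ j + k * 4 ^ j * ((1 / 8 : ℝ) ^ j * E j) := by
          calc _ = k * ((1 / 32 : ℝ) ^ j * 16 ^ j) + k * ((1 / 32 : ℝ) ^ j * 16 ^ j) * E j := by
                ring
            _ = _ := by rw [e1]; nth_rewrite 2 [e2]; ring
        rw [this]
        have := hE0 j
        gcongr
    _ = 2 * (k * ∑ j ∈ Finset.range (J + 1), (1 / 2 : ℝ) ^ j + k * 4 ^ J *
          gridEnergy fun y => q y - 1 / (k * 16 ^ J)) := by
        rw [Finset.sum_add_distrib, ← Finset.mul_sum, ← Finset.mul_sum, gridEnergy]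
        simp only [hE, mul_assoc]
    _ ≤ _ := by
        have := mul_le_mul_of_nonneg_left (geom (J + 1)) hk'.le
        linarith

theorem gridEnergy_nonneg (d : Fin (k * 16 ^ J) → ℝ) : 0 ≤ gridEnergy d :=
  Finset.sum_nonneg fun _ _ =>
    mul_nonneg (by positivity) (Finset.sum_nonneg fun _ _ => sq_nonneg _)

theorem gridEnergy_zero : gridEnergy (fun _ : Fin (k * 16 ^ J) => 0) = 0 := by
  simp [gridEnergy, gridSum]

/-- A sum over a union of cells is bounded by the number of cells and the energy of the grid. -/
theorem sq_sum_le_card_image_mul {j : ℕ} (hj : j ≤ J) (d : Fin (k * 16 ^ J) → ℝ)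
    (V : Finset (Fin (k * 16 ^ J)))
    (hV : ∀ y ∈ V, ∀ z : Fin (k * 16 ^ J), gridCell J j z = gridCell J j y → z ∈ V) :
    (∑ y ∈ V, d y) ^ 2 ≤ (V.image fun y : Fin (k * 16 ^ J) => gridCell J j y).card *
      ∑ b ∈ Finset.range (k * 16 ^ j), gridSum j d b ^ 2 := by
  have e : ∑ y ∈ V, d y =
      ∑ b ∈ V.image fun y : Fin (k * 16 ^ J) => gridCell J j y, gridSum j d b := by
    rw [← Finset.sum_fiberwise_of_maps_to
      (fun y hy => Finset.mem_image_of_mem (fun y : Fin (k * 16 ^ J) => gridCell J j y) hy)]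
    refine Finset.sum_congr rfl fun b hb => ?_
    rw [gridSum]
    refine Finset.sum_congr (Finset.ext fun y => ?_) fun _ _ => rfl
    simp only [Finset.mem_filter, Finset.mem_univ, true_and, and_iff_right_iff_imp]
    intro hy
    obtain ⟨z, hz, rfl⟩ := Finset.mem_image.1 hb
    exact hV z hz y hy
  rw [e]
  refine sq_sum_le_card_mul_sum_sq.trans (mul_le_mul_of_nonneg_left
    (Finset.sum_le_sum_of_subset_of_nonneg ?_ fun _ _ _ => sq_nonneg _) (Nat.cast_nonneg _))
  intro b hb
  obtain ⟨z, _, rfl⟩ := Finset.mem_image.1 hb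
  exact Finset.mem_range.2 (gridCell_lt hj z.2)

/-- A set of points with few boundary cells at every scale detects at most the multiscale energy:
it is a union of few cells of each grid. -/
theorem sq_sum_le_gridEnergy (hk : 0 < k) (d : Fin (k * 16 ^ J) → ℝ)
    (B : Finset (Fin (k * 16 ^ J)))
    (hB : ∀ j < J, ((B.filter fun y : Fin (k * 16 ^ J) => ∃ z ∉ B, gridCell J j z = gridCell J j y).image
      fun y : Fin (k * 16 ^ J) => gridCell J j y).card ≤ k) :
    (∑ y ∈ B, d y) ^ 2 ≤ 32 * gridEnergy d := by
  classical
  have hk' : (0 : ℝ) < k := by exact_mod_cast hk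
  -- `U j` is the union of the level-`j` cells contained in `B`, and `V j` is what is new at level
  -- `j`. The `V j` partition `B` because level `J` consists of single points.
  let U : ℕ → Finset (Fin (k * 16 ^ J)) := fun j =>
    Finset.univ.filter fun y => ∀ z : Fin (k * 16 ^ J), gridCell J j z = gridCell J j y → z ∈ B
  let V : ℕ → Finset (Fin (k * 16 ^ J)) := fun j => j.casesOn (U 0) fun i => U (i + 1) \ U i
  have memU : ∀ j y, y ∈ U j ↔ ∀ z : Fin (k * 16 ^ J),
      gridCell J j z = gridCell J j y → z ∈ B := fun j y => by simp [U]
  have satU : ∀ j, ∀ y ∈ U j, ∀ z : Fin (k * 16 ^ J), gridCell J j z = gridCell J j y →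
      z ∈ U j := fun j y hy z hz => by
    rw [memU] at hy ⊢
    exact fun w hw => hy w (hw.trans hz)
  have coarse : ∀ j < J, ∀ y z : Fin (k * 16 ^ J), gridCell J (j + 1) z = gridCell J (j + 1) y →
      gridCell J j z = gridCell J j y := fun j hj y z h => by
    rw [← gridCell_succ_div hj, ← gridCell_succ_div hj, h]
  have mono : ∀ j < J, U j ⊆ U (j + 1) := fun j hj y hy => by
    rw [memU] at hy ⊢
    exact fun z hz => hy z (coarse j hj y z hz)
  have UJ : U J = B := by
    ext y
    rw [memU]
    simp only [gridCell_self, Fin.val_inj]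
    exact ⟨fun h => h y rfl, fun h z hz => hz ▸ h⟩
  have satV : ∀ j ≤ J, ∀ y ∈ V j, ∀ z : Fin (k * 16 ^ J), gridCell J j z = gridCell J j y →
      z ∈ V j := by
    rintro (_ | j) hj y hy z hz
    · exact satU 0 y hy z hz
    · obtain ⟨h1, h2⟩ := Finset.mem_sdiff.1 hy
      exact Finset.mem_sdiff.2 ⟨satU _ y h1 z hz, fun h =>
        h2 (satU _ z h y (coarse j hj y z hz).symm)⟩
  have cardV : ∀ j ≤ J, (((V j).image fun y : Fin (k * 16 ^ J) => gridCell J j y).card : ℝ) ≤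
      16 * k := by
    rintro (_ | j) hj
    · have : ((V 0).image fun y : Fin (k * 16 ^ J) => gridCell J 0 y) ⊆ Finset.range k := by
        intro b hb
        obtain ⟨z, _, rfl⟩ := Finset.mem_image.1 hb
        simpa using gridCell_lt hj z.2
      have := Finset.card_le_card this
      rw [Finset.card_range] at this
      have : (((V 0).image fun y : Fin (k * 16 ^ J) => gridCell J 0 y).card : ℝ) ≤ k := by
        exact_mod_cast this
      linarith
    · set W := (V (j + 1)).image fun y : Fin (k * 16 ^ J) => gridCell J (j + 1) y with hW
      have h1 : W.card ≤ 16 * (W.image (· / 16)).card := by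
        refine Finset.card_le_mul_card_image W 16 fun c _ => ?_
        have : W.filter (fun b => b / 16 = c) ⊆ Finset.Ico (c * 16) (c * 16 + 16) := by
          intro b hb
          have := (Finset.mem_filter.1 hb).2
          rw [Finset.mem_Ico]
          omega
        simpa using Finset.card_le_card this
      -- The parent of a newly contained cell meets `B` without being contained in it, so it is one
      -- of the at most `k` boundary cells; each parent has 16 children.
      have h2 : W.image (· / 16) ⊆
          (B.filter fun y : Fin (k * 16 ^ J) => ∃ z ∉ B, gridCell J j z = gridCell J j y).image
            fun y : Fin (k * 16 ^ J) => gridCell J j y := by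
        intro c hc
        obtain ⟨b, hb, rfl⟩ := Finset.mem_image.1 hc
        obtain ⟨y, hy, rfl⟩ := Finset.mem_image.1 hb
        obtain ⟨hy1, hy2⟩ := Finset.mem_sdiff.1 hy
        rw [memU] at hy1 hy2
        push Not at hy2
        obtain ⟨z, hz, hzB⟩ := hy2
        exact Finset.mem_image.2 ⟨y, Finset.mem_filter.2 ⟨hy1 y rfl, z, hzB, hz⟩,
          (gridCell_succ_div hj _).symm⟩
      have := h1.trans (Nat.mul_le_mul_left 16 ((Finset.card_le_card h2).trans (hB j hj)))
      exact_mod_cast this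
  have tele : ∀ i ≤ J, ∑ y ∈ U i, d y = ∑ j ∈ Finset.range (i + 1), ∑ y ∈ V j, d y := by
    intro i
    induction i with
    | zero => intro _; simp [V]
    | succ i ih =>
      intro hi
      rw [Finset.sum_range_succ, ← ih (by omega), add_comm (∑ y ∈ U i, d y)]
      exact (Finset.sum_sdiff (mono i hi)).symm
  rw [← UJ, tele J le_rfl]
  -- The weights match exactly: `2 ^ (-j) * 8 ^ (-j) * 16 ^ j = 1`. The factor 32 is 16 children
  -- times the geometric sum 2.
  refine (Finset.sum_sq_le_sum_mul_sum_of_sq_le_mul _ (f := fun j => (1 / 2 : ℝ) ^ j)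
    (g := fun j => 16 * ((1 / 8 : ℝ) ^ j * (k * 16 ^ j) *
      ∑ b ∈ Finset.range (k * 16 ^ j), gridSum j d b ^ 2))
    (fun j _ => by positivity) (fun j _ => ?_) fun j hj => ?_).trans ?_
  · have : 0 ≤ ∑ b ∈ Finset.range (k * 16 ^ j), gridSum j d b ^ 2 :=
      Finset.sum_nonneg fun _ _ => sq_nonneg _
    positivity
  · have hj' : j ≤ J := Nat.lt_succ_iff.1 (Finset.mem_range.1 hj)
    have h0 : 0 ≤ ∑ b ∈ Finset.range (k * 16 ^ j), gridSum j d b ^ 2 :=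
      Finset.sum_nonneg fun _ _ => sq_nonneg _
    refine (sq_sum_le_card_image_mul hj' d (V j) (satV j hj')).trans
      ((mul_le_mul_of_nonneg_right (cardV j hj') h0).trans (le_of_eq ?_))
    have : (1 / 2 : ℝ) ^ j * ((1 / 8) ^ j * 16 ^ j) = 1 := by
      rw [← mul_pow, ← mul_pow]; norm_num
    linear_combination (-16 * k * ∑ b ∈ Finset.range (k * 16 ^ j), gridSum j d b ^ 2) * this
  · rw [← Finset.mul_sum, ← gridEnergy]
    have := gridEnergy_nonneg d
    nlinarith [sum_geometric_two_le (J + 1)]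

end Grid

/-! ### Monotone coupling and its effect on interval partitions. -/

section Staircase

variable {n k L : ℕ}

/-- Each mixed `b` is related to two indices `f b < g b` in different parts. For `b < b'` the
staircase condition gives `g b ≤ f b'`; if `f b` and `f b'` shared a part, that interval would
contain `g b` too. So `b ↦ part (f b)` is injective into the `k` parts. -/
theorem card_le_of_staircase (P : IntervalPartition n k) {𝒜 : Finset (Finset (Fin n))}
    (h𝒜 : 𝒜 ⊆ P.1.parts) {R : Fin n → ℕ → Prop}
    (hR : ∀ i i' b b', i < i' → b < b' → R i b' → R i' b → False) (M : Finset ℕ)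
    (hM : ∀ b ∈ M, ∃ i i', (∃ I ∈ 𝒜, i ∈ I) ∧ (¬∃ I ∈ 𝒜, i' ∈ I) ∧ R i b ∧ R i' b) :
    M.card ≤ k := by
  classical
  have part_ne : ∀ i i' : Fin n, (∃ I ∈ 𝒜, i ∈ I) → (¬∃ I ∈ 𝒜, i' ∈ I) →
      P.1.part i ≠ P.1.part i' := by
    rintro i i' ⟨I, hI, hi⟩ h' he
    refine h' ⟨I, hI, ?_⟩
    rw [← P.1.part_eq_of_mem (h𝒜 hI) hi, he]
    exact P.1.mem_part (Finset.mem_univ _)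
  have hM' : ∀ b ∈ M, ∃ i i', i < i' ∧ P.1.part i ≠ P.1.part i' ∧ R i b ∧ R i' b := by
    intro b hb
    obtain ⟨i, i', hi, hi', h, h'⟩ := hM b hb
    have hne := part_ne i i' hi hi'
    rcases lt_trichotomy i i' with hlt | rfl | hlt
    · exact ⟨i, i', hlt, hne, h, h'⟩
    · exact absurd rfl hne
    · exact ⟨i', i, hlt, hne.symm, h', h⟩
  rcases M.eq_empty_or_nonempty with rfl | ⟨b₀, hb₀⟩
  · simp
  have : Nonempty (Fin n) := ⟨(hM' b₀ hb₀).choose⟩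
  choose! f g hlt hne hf hg using hM'
  have key : ∀ b ∈ M, ∀ b' ∈ M, b < b' → P.1.part (f b) ≠ P.1.part (f b') := by
    intro b hb b' hb' hbb he
    have hle : g b ≤ f b' := not_lt.1 fun h => hR _ _ _ _ h hbb (hf b' hb') (hg b hb)
    have hmem : g b ∈ P.1.part (f b) := by
      have := (P.2.2 _ (P.1.part_mem.2 (Finset.mem_univ (f b)))).out
        (Finset.mem_coe.2 (P.1.mem_part (Finset.mem_univ (f b))))
        (Finset.mem_coe.2 (he ▸ P.1.mem_part (Finset.mem_univ (f b'))))
      exact Finset.mem_coe.1 (this ⟨(hlt b hb).le, hle⟩)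
    exact hne b hb (P.1.part_eq_of_mem (P.1.part_mem.2 (Finset.mem_univ _)) hmem).symm
  rw [← P.2.1]
  refine Finset.card_le_card_of_injOn (fun b => P.1.part (f b))
    (fun b _ => P.1.part_mem.2 (Finset.mem_univ _)) ?_
  intro b hb b' hb' he
  rcases lt_trichotomy b b' with h | h | h
  · exact absurd he (key b hb b' hb' h)
  · exact h
  · exact absurd he.symm (key b' hb' b hb h)

/-- The monotone coupling of a distribution of full support with the uniform distribution. -/
theorem exists_staircase_kernel {p : Fin n → ℝ} (hp : ∀ i, 0 < p i) (hp1 : ∑ i, p i = 1)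
    (hL : 0 < L) :
    ∃ κ : Fin n → Fin L → ℝ, (∀ i a, 0 ≤ κ i a) ∧ (∀ i, ∑ a, κ i a = 1) ∧
      (∀ a, ∑ i, p i * κ i a = 1 / L) ∧
      ∀ i i' a a', i < i' → a < a' → κ i a' ≠ 0 → κ i' a ≠ 0 → False := by
  have hL' : (0 : ℝ) < L := by exact_mod_cast hL
  let p' : ℕ → ℝ := fun t => if h : t < n then p ⟨t, h⟩ else 0
  have hp' : ∀ i : Fin n, p' i = p i := fun i => by simp [p']
  have hp0 : ∀ t, 0 ≤ p' t := fun t => by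
    simp only [p']
    split_ifs
    exacts [(hp _).le, le_rfl]
  let F : ℕ → ℝ := fun t => ∑ s ∈ Finset.range t, p' s
  have F0 : F 0 = 0 := by simp [F]
  have Fn : F n = 1 := by
    rw [← hp1]
    refine (Fin.sum_univ_eq_sum_range p' n).symm.trans ?_
    exact Finset.sum_congr rfl fun i _ => hp' i
  have Fs : ∀ i : Fin n, F (i + 1) = F i + p i := fun i => by
    simp only [F, Finset.sum_range_succ, hp']
  have Fmono : Monotone F := monotone_nat_of_le_succ fun t => by
    simp only [F, Finset.sum_range_succ]
    linarith [hp0 t]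
  -- For `v ≥ 0` this is the length of `[0, v] ∩ [a / L, (a + 1) / L]`. The kernel below is the
  -- overlap of the quantile interval of `i` with the cell of `a`, divided by `p i`.
  let φ : ℕ → ℝ → ℝ := fun a v => min v ((a + 1) / L) - min v (a / L)
  have hle : ∀ a : ℕ, (a : ℝ) / L ≤ (a + 1) / L := fun a => by gcongr; linarith
  have φmono : ∀ a, Monotone (φ a) := fun a v w hvw => by
    have := hle a
    simp only [φ]
    rcases le_total v (a / L) with h1 | h1 <;> rcases le_total v ((a + 1) / L) with h2 | h2 <;>
    rcases le_total w (a / L) with h3 | h3 <;> rcases le_total w ((a + 1) / L) with h4 | h4 <;>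
    simp only [min_eq_left, min_eq_right, *] <;> linarith
  have φlow : ∀ (a : ℕ) (v : ℝ), v ≤ a / L → φ a v = 0 := fun a v h => by
    simp [φ, min_eq_left h, min_eq_left (h.trans (hle a))]
  have φhigh : ∀ (a : ℕ) (v : ℝ), (a + 1) / L ≤ v → φ a v = 1 / L := fun a v h => by
    simp only [φ, min_eq_right h, min_eq_right ((hle a).trans h)]
    ring
  have φsum : ∀ v, 0 ≤ v → v ≤ 1 → ∑ a : Fin L, φ a v = v := fun v h0 h1 => by
    rw [Fin.sum_univ_eq_sum_range (fun a => φ a v) L]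
    have := Finset.sum_range_sub (fun a : ℕ => min v ((a : ℝ) / L)) L
    simp only [Nat.cast_add, Nat.cast_one, Nat.cast_zero, zero_div, min_eq_right h0,
      div_self hL'.ne', min_eq_left h1, sub_zero] at this
    exact this
  have F01 : ∀ t ≤ n, 0 ≤ F t ∧ F t ≤ 1 := fun t ht =>
    ⟨F0 ▸ Fmono (Nat.zero_le t), Fn ▸ Fmono ht⟩
  refine ⟨fun i a => (φ a (F (i + 1)) - φ a (F i)) / p i, fun i a => ?_, fun i => ?_, fun a => ?_,
    ?_⟩
  · exact div_nonneg (sub_nonneg.2 (φmono a (Fmono (Nat.le_succ _)))) (hp i).le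
  · obtain ⟨h1, h2⟩ := F01 (i + 1) i.2
    obtain ⟨h3, h4⟩ := F01 i i.2.le
    rw [← Finset.sum_div, Finset.sum_sub_distrib, φsum _ h1 h2, φsum _ h3 h4, Fs,
      add_sub_cancel_left, div_self (hp i).ne']
  · have e : ∀ i : Fin n, p i * ((φ a (F (i + 1)) - φ a (F i)) / p i) =
        φ a (F (i + 1)) - φ a (F i) := fun i => mul_div_cancel₀ _ (hp i).ne'
    simp only [e]
    rw [Fin.sum_univ_eq_sum_range (fun t => φ a (F (t + 1)) - φ a (F t)) n,
      Finset.sum_range_sub (fun t => φ a (F t)), Fn, F0, φlow a 0 (by positivity), sub_zero]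
    refine φhigh a 1 ?_
    rw [div_le_one hL']
    exact_mod_cast a.2
  · intro i i' a a' hi ha h h'
    have h1 : (a' : ℝ) / L < F (i + 1) := not_le.1 fun hc => h <| by
      simp only [φlow a' _ hc, φlow a' _ ((Fmono (Nat.le_succ _)).trans hc), sub_self, zero_div]
    have h2 : F i' < ((a : ℕ) + 1) / L := not_le.1 fun hc => h' <| by
      simp only [φhigh a _ hc, φhigh a _ (hc.trans (Fmono (Nat.le_succ _))), sub_self, zero_div]
    have h3 : F (i + 1) ≤ F i' := Fmono (Nat.succ_le_of_lt hi)
    have h4 : (((a : ℕ) : ℝ) + 1) / L ≤ (a' : ℕ) / L := by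
      gcongr
      exact_mod_cast ha
    linarith

/-- A deficit of `q` on a union of parts of an interval partition is detected by the multiscale
energy: it persists on the set of grid points that receive mass from these parts only. -/
theorem exists_grid_deficit {J : ℕ} (hk : 0 < k) (P : IntervalPartition n k)
    {p q : Fin n → ℝ} (hq : ∀ i, 0 ≤ q i)
    {κ : Fin n → Fin (k * 16 ^ J) → ℝ} (hκ : ∀ i a, 0 ≤ κ i a) (hκ1 : ∀ i, ∑ a, κ i a = 1)
    (hκp : ∀ a, ∑ i, p i * κ i a = 1 / (k * 16 ^ J)) (hp : ∀ i, 0 ≤ p i)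
    (hst : ∀ i i' a a', i < i' → a < a' → κ i a' ≠ 0 → κ i' a ≠ 0 → False)
    {δ : ℝ} {𝒜 : Finset (Finset (Fin n))} (h𝒜 : 𝒜 ⊆ P.1.parts)
    (hδ : δ ≤ ∑ I ∈ 𝒜, (∑ i ∈ I, p i - ∑ i ∈ I, q i)) (hδ0 : 1 / 16 ^ J ≤ δ) :
    (δ - 1 / 16 ^ J) ^ 2 ≤ 32 * gridEnergy fun a => ∑ i, q i * κ i a - 1 / (k * 16 ^ J) := by
  classical
  have hk' : (0 : ℝ) < k := by exact_mod_cast hk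
  let A : Finset (Fin n) := 𝒜.biUnion id
  have memA : ∀ i, i ∈ A ↔ ∃ I ∈ 𝒜, i ∈ I := fun i => by simp [A]
  have sumA : ∀ f : Fin n → ℝ, ∑ i ∈ A, f i = ∑ I ∈ 𝒜, ∑ i ∈ I, f i := fun f =>
    Finset.sum_biUnion fun I hI I' hI' h => P.1.disjoint (h𝒜 hI) (h𝒜 hI') h
  -- Only points fed exclusively by `A` are kept, so the image of `q` has mass at most `q(A)` on
  -- `B`; for `p` only the ambiguous points `M` are lost.
  let B : Finset (Fin (k * 16 ^ J)) := Finset.univ.filter fun a => ∀ i ∉ A, κ i a = 0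
  have memB : ∀ a, a ∈ B ↔ ∀ i ∉ A, κ i a = 0 := fun a => by simp [B]
  have hpos : ∀ a, ∃ i, κ i a ≠ 0 := fun a => by
    by_contra! h
    have := hκp a
    simp only [h, mul_zero, Finset.sum_const_zero] at this
    have : (0 : ℝ) < 1 / (k * 16 ^ J) := by positivity
    linarith
  -- A cell fed from both inside and outside `A` is mixed for the staircase count. This covers
  -- boundary cells of `B` at coarse scales and, at scale `J`, the points of `M`.
  have mixed : ∀ j (M : Finset ℕ), (∀ b ∈ M, ∃ i ∈ A, ∃ i' ∉ A, ∃ a a' : Fin (k * 16 ^ J),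
      gridCell J j a = b ∧ gridCell J j a' = b ∧ κ i a ≠ 0 ∧ κ i' a' ≠ 0) → M.card ≤ k := by
    intro j M hM
    refine card_le_of_staircase P h𝒜
      (R := fun i b => ∃ a : Fin (k * 16 ^ J), gridCell J j a = b ∧ κ i a ≠ 0) ?_ M ?_
    · rintro i i' b b' hi hb ⟨a', rfl, h'⟩ ⟨a, rfl, h⟩
      refine hst i i' a a' hi (not_le.1 fun hc => ?_) h' h
      exact absurd (Nat.div_le_div_right (c := 16 ^ (J - j)) (Fin.le_def.1 hc)) (not_le.2 hb)
    · intro b hb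
      obtain ⟨i, hi, i', hi', a, a', ha, ha', h, h'⟩ := hM b hb
      exact ⟨i, i', (memA i).1 hi, fun hc => hi' ((memA i').2 hc), ⟨a, ha, h⟩, ⟨a', ha', h'⟩⟩
  have hcells : ∀ j < J, ((B.filter fun y : Fin (k * 16 ^ J) =>
      ∃ z ∉ B, gridCell J j z = gridCell J j y).image
        fun y : Fin (k * 16 ^ J) => gridCell J j y).card ≤ k := by
    intro j _
    refine mixed j _ fun b hb => ?_
    obtain ⟨y, hy, rfl⟩ := Finset.mem_image.1 hb
    obtain ⟨hyB, z, hzB, hz⟩ := Finset.mem_filter.1 hy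
    obtain ⟨i, hi⟩ := hpos y
    rw [memB] at hyB hzB
    push Not at hzB
    obtain ⟨i', hi', h'⟩ := hzB
    exact ⟨i, by_contra fun h => hi (hyB i h), i', hi', y, z, rfl, hz, hi, h'⟩
  have hq' : ∑ a ∈ B, ∑ i, q i * κ i a ≤ ∑ i ∈ A, q i := by
    calc ∑ a ∈ B, ∑ i, q i * κ i a = ∑ a ∈ B, ∑ i ∈ A, q i * κ i a :=
          Finset.sum_congr rfl fun a ha => (Finset.sum_subset (Finset.subset_univ A)
            fun i _ hi => by rw [(memB a).1 ha i hi, mul_zero]).symm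
      _ ≤ ∑ a, ∑ i ∈ A, q i * κ i a :=
          Finset.sum_le_sum_of_subset_of_nonneg (Finset.subset_univ B) fun a _ _ =>
            Finset.sum_nonneg fun i _ => mul_nonneg (hq i) (hκ i a)
      _ = ∑ i ∈ A, q i := by
          rw [Finset.sum_comm]
          simp only [← Finset.mul_sum, hκ1, mul_one]
  let M : Finset (Fin (k * 16 ^ J)) :=
    Finset.univ.filter fun a => a ∉ B ∧ ∃ i ∈ A, κ i a ≠ 0
  have hM : (M.card : ℝ) ≤ k := by
    have h1 : (M.image fun y : Fin (k * 16 ^ J) => gridCell J J y).card = M.card :=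
      Finset.card_image_of_injective _ fun y z h => by
        simpa only [gridCell_self, Fin.val_inj] using h
    have h2 : (M.image fun y : Fin (k * 16 ^ J) => gridCell J J y).card ≤ k := by
      refine mixed J _ fun b hb => ?_
      obtain ⟨y, hy, rfl⟩ := Finset.mem_image.1 hb
      obtain ⟨hyB, i, hi, h⟩ := (Finset.mem_filter.1 hy).2
      rw [memB] at hyB
      push Not at hyB
      obtain ⟨i', hi', h'⟩ := hyB
      exact ⟨i, hi, i', hi', y, y, rfl, rfl, h, h'⟩
    exact_mod_cast h1 ▸ h2
  have hp' : ∑ i ∈ A, p i ≤ ∑ a ∈ B, (1 / (k * 16 ^ J) : ℝ) + 1 / 16 ^ J := by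
    calc ∑ i ∈ A, p i = ∑ a, ∑ i ∈ A, p i * κ i a := by
          rw [Finset.sum_comm]
          simp only [← Finset.mul_sum, hκ1, mul_one]
      _ = ∑ a ∈ B ∪ M, ∑ i ∈ A, p i * κ i a := by
          refine (Finset.sum_subset (Finset.subset_univ _) fun a _ ha => ?_).symm
          rw [Finset.mem_union, not_or] at ha
          refine Finset.sum_eq_zero fun i hi => ?_
          by_contra hne
          exact ha.2 (Finset.mem_filter.2 ⟨Finset.mem_univ _, ha.1, i, hi,
            right_ne_zero_of_mul hne⟩)
      _ ≤ ∑ a ∈ B ∪ M, (1 / (k * 16 ^ J) : ℝ) := Finset.sum_le_sum fun a _ => by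
          rw [← hκp a]
          exact Finset.sum_le_sum_of_subset_of_nonneg (Finset.subset_univ A) fun i _ _ =>
            mul_nonneg (hp i) (hκ i a)
      _ = ∑ a ∈ B, (1 / (k * 16 ^ J) : ℝ) + M.card * (1 / (k * 16 ^ J)) := by
          rw [Finset.sum_union, Finset.sum_const (s := M), nsmul_eq_mul]
          exact Finset.disjoint_left.2 fun a ha ha' => (Finset.mem_filter.1 ha').2.1 ha
      _ ≤ _ := by
          gcongr
          calc M.card * (1 / (k * 16 ^ J) : ℝ) ≤ k * (1 / (k * 16 ^ J) : ℝ) := by gcongr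
            _ = _ := by field_simp
  refine le_trans ?_ (sq_sum_le_gridEnergy hk _ B hcells)
  have := hδ.trans_eq (by rw [Finset.sum_sub_distrib, ← sumA, ← sumA])
  rw [Finset.sum_sub_distrib, ← neg_sq (∑ a ∈ B, ∑ i, q i * κ i a - _)]
  exact pow_le_pow_left₀ (by linarith) (by linarith) 2

end Staircase

/-! ### Chebyshev analysis of the uniformity test. -/

section UniformityTest

variable {k J m : ℕ} {q : Fin (k * 16 ^ J) → ℝ} {θ₀ : ℝ}

theorem iidExp_crossStat_gridKernel_sub_sq_le (hk : 0 < k) (hq : ∀ a, 0 ≤ q a)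
    (hq1 : ∑ a, q a = 1) {A : ℝ} (hA : 0 ≤ A)
    (hA2 : 4 * k + 2 * k * 4 ^ J * gridEnergy (fun y => q y - 1 / (k * 16 ^ J)) ≤ A ^ 2) :
    iidExp (m + m) q (fun x => (crossStat (gridKernel k J) x -
      (m : ℝ) ^ 2 * gridEnergy (fun y => q y - 1 / (k * 16 ^ J))) ^ 2) ≤
      (m : ℝ) ^ 2 * A ^ 2 +
        2 * (m : ℝ) ^ 3 * (A * gridEnergy (fun y => q y - 1 / (k * 16 ^ J))) :=
  iidExp_crossStat_sub_sq_le hq hq1 _ (fun _ _ => by positivity) _ (gridKernel_eq_sum hk) hA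
    ((sum_mul_mul_gridKernel_sq_le hk hq hq1).trans hA2) (sum_mul_mul_gridKernel hk hq1)

theorem iidExp_accept_uniform (hk : 0 < k) (hm : 0 < m) (hθ₀ : 0 < θ₀)
    (h1 : 4 * k ≤ ((m : ℝ) * θ₀) ^ 2 / 2048) :
    2 / 3 ≤ iidExp (m + m) (fun _ : Fin (k * 16 ^ J) => (1 / (k * 16 ^ J) : ℝ))
      (fun x => if crossStat (gridKernel k J) x < (m : ℝ) ^ 2 * θ₀ / 2 then 1 else 0) := by
  have hk' : (0 : ℝ) < k := by exact_mod_cast hk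
  have hm' : (0 : ℝ) < m := by exact_mod_cast hm
  have hq : ∀ a : Fin (k * 16 ^ J), (0 : ℝ) ≤ (fun _ => (1 / (k * 16 ^ J) : ℝ)) a :=
    fun _ => by positivity
  have hq1 : ∑ _a : Fin (k * 16 ^ J), (1 / (k * 16 ^ J) : ℝ) = 1 := by
    rw [Finset.sum_const, Finset.card_univ, Fintype.card_fin, nsmul_eq_mul]
    push_cast
    field_simp
  have hV := iidExp_crossStat_gridKernel_sub_sq_le (m := m) hk hq hq1 (A := m * θ₀ / 32)
    (by positivity) (by
      simp only [sub_self, gridEnergy_zero]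
      nlinarith [sq_nonneg ((m : ℝ) * θ₀)])
  have hc := iidExp_indicator_le hq (r := (m : ℝ) ^ 2 * θ₀ / 2) (by positivity) hV
    (fun x => ¬crossStat (gridKernel k J) x < (m : ℝ) ^ 2 * θ₀ / 2) fun x hx => by
      simp only [sub_self, gridEnergy_zero, mul_zero, sub_zero]
      exact (not_lt.1 hx).trans (le_abs_self _)
  have hadd := iidExp_add (m := m + m) (q := fun _ : Fin (k * 16 ^ J) => (1 / (k * 16 ^ J) : ℝ))
    (fun x => if crossStat (gridKernel k J) x < (m : ℝ) ^ 2 * θ₀ / 2 then 1 else 0)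
    (fun x => if ¬crossStat (gridKernel k J) x < (m : ℝ) ^ 2 * θ₀ / 2 then 1 else 0)
  have e : ∀ x : Fin (m + m) → Fin (k * 16 ^ J),
      ((if crossStat (gridKernel k J) x < (m : ℝ) ^ 2 * θ₀ / 2 then 1 else 0) +
        if ¬crossStat (gridKernel k J) x < (m : ℝ) ^ 2 * θ₀ / 2 then 1 else 0 : ℝ) = 1 :=
    fun x => by split_ifs <;> norm_num
  simp only [e, iidExp_const hq1] at hadd
  have hval : ((m : ℝ) ^ 2 * (m * θ₀ / 32) ^ 2 + 2 * (m : ℝ) ^ 3 * (m * θ₀ / 32 *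
      gridEnergy (fun _ : Fin (k * 16 ^ J) => (1 / (k * 16 ^ J) : ℝ) - 1 / (k * 16 ^ J)))) /
        ((m : ℝ) ^ 2 * θ₀ / 2) ^ 2 ≤ 1 / 3 := by
    simp only [sub_self, gridEnergy_zero]
    rw [div_le_iff₀ (by positivity)]
    nlinarith [sq_nonneg ((m : ℝ) ^ 2 * θ₀)]
  linarith

theorem iidExp_reject_far (hk : 0 < k) (hm : 0 < m) (hθ₀ : 0 < θ₀) (hq : ∀ a, 0 ≤ q a)
    (hq1 : ∑ a, q a = 1) (hθ : θ₀ ≤ gridEnergy fun y => q y - 1 / (k * 16 ^ J))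
    (h1 : 4 * k ≤ ((m : ℝ) * θ₀) ^ 2 / 2048) (h2 : 2 * k * 4 ^ J ≤ (m : ℝ) ^ 2 * θ₀ / 2048) :
    2 / 3 ≤ iidExp (m + m) q
      (fun x => 1 - if crossStat (gridKernel k J) x < (m : ℝ) ^ 2 * θ₀ / 2 then 1 else 0) := by
  have hm' : (0 : ℝ) < m := by exact_mod_cast hm
  have hV := iidExp_crossStat_gridKernel_sub_sq_le (m := m) hk hq hq1
    -- `A` scales with the true energy `θ`. Half of `A ^ 2 = (m * θ) ^ 2 / 1024` absorbs `4 * k` by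
    -- `h1`, the other half absorbs the `4 ^ J` term by `h2`.
    (A := m * (gridEnergy fun y => q y - 1 / (k * 16 ^ J)) / 32)
    (by have := hθ₀.trans_le hθ; positivity) (by
      have hp := hθ₀.trans_le hθ
      generalize gridEnergy (fun y => q y - 1 / (k * 16 ^ J)) = θ at hθ hp
      have i1 : ((m : ℝ) * θ₀) ^ 2 ≤ (m * θ) ^ 2 := by gcongr
      have i2 : 2 * k * 4 ^ J * θ ≤ (m : ℝ) ^ 2 * θ / 2048 * θ := by
        refine mul_le_mul_of_nonneg_right (h2.trans ?_) hp.le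
        gcongr
      linarith [show ((m : ℝ) * θ / 32) ^ 2 =
        (m * θ) ^ 2 / 2048 + (m : ℝ) ^ 2 * θ / 2048 * θ by ring])
  generalize gridEnergy (fun y => q y - 1 / (k * 16 ^ J)) = θ at hθ hV
  have hp := hθ₀.trans_le hθ
  have hc := iidExp_indicator_le hq (r := (m : ℝ) ^ 2 * θ / 2) (by positivity) hV
    (fun x => crossStat (gridKernel k J) x < (m : ℝ) ^ 2 * θ₀ / 2) fun x hx => by
      rw [abs_sub_comm]
      refine le_trans ?_ (le_abs_self _)
      have : (m : ℝ) ^ 2 * θ₀ ≤ (m : ℝ) ^ 2 * θ := by gcongr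
      linarith
  have hadd := iidExp_add (m := m + m) (q := q)
    (fun x => if crossStat (gridKernel k J) x < (m : ℝ) ^ 2 * θ₀ / 2 then 1 else 0)
    (fun x => 1 - if crossStat (gridKernel k J) x < (m : ℝ) ^ 2 * θ₀ / 2 then 1 else 0)
  simp only [add_sub_cancel, iidExp_const hq1] at hadd
  -- The ratio equals `4 * (1 / 1024 + 1 / 16)`, just over `1 / 4`.
  have hval : ((m : ℝ) ^ 2 * (m * θ / 32) ^ 2 + 2 * (m : ℝ) ^ 3 * (m * θ / 32 * θ)) /
        ((m : ℝ) ^ 2 * θ / 2) ^ 2 ≤ 1 / 3 := by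
    rw [div_le_iff₀ (by positivity)]
    nlinarith [sq_nonneg ((m : ℝ) ^ 2 * θ)]
  linarith

end UniformityTest

/-! ### Reduction of identity testing to uniformity testing. -/

section IdentityTest

variable {n k : ℕ}

/-- If two distributions are far in `A_k`-distance, then the deficient parts of some partition carry
half of this distance. -/
theorem exists_deficient_parts {p q : Fin n → ℝ} (hp1 : ∑ i, p i = 1) (hq1 : ∑ i, q i = 1) {δ : ℝ}
    (hδ : 0 < δ) (h : 2 * δ ≤ akDist k q p) :
    ∃ (P : IntervalPartition n k) (𝒜 : Finset (Finset (Fin n))), 𝒜 ⊆ P.1.parts ∧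
      δ ≤ ∑ I ∈ 𝒜, (∑ i ∈ I, p i - ∑ i ∈ I, q i) := by
  classical
  rcases isEmpty_or_nonempty (IntervalPartition n k) with he | he
  · rw [akDist, Real.iSup_of_isEmpty] at h
    linarith
  obtain ⟨P, hP⟩ := exists_eq_ciSup_of_finite (f := fun P : IntervalPartition n k =>
    ∑ I ∈ P.1.parts, |∑ i ∈ I, q i - ∑ i ∈ I, p i|)
  rw [akDist, ← hP] at h
  refine ⟨P, P.1.parts.filter fun I => ∑ i ∈ I, q i < ∑ i ∈ I, p i, Finset.filter_subset _ _, ?_⟩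
  have tot : ∀ f : Fin n → ℝ, ∑ I ∈ P.1.parts, ∑ i ∈ I, f i = ∑ i, f i := fun f => by
    have := Finset.sum_biUnion (f := f) P.1.disjoint
    rw [P.1.biUnion_parts] at this
    exact this.symm
  have h0 : ∑ I ∈ P.1.parts, (∑ i ∈ I, q i - ∑ i ∈ I, p i) = 0 := by
    rw [Finset.sum_sub_distrib, tot, tot, hp1, hq1, sub_self]
  have h1 : 2 * ∑ I ∈ P.1.parts.filter fun I => ∑ i ∈ I, q i < ∑ i ∈ I, p i,
        (∑ i ∈ I, p i - ∑ i ∈ I, q i) =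
      ∑ I ∈ P.1.parts, |∑ i ∈ I, q i - ∑ i ∈ I, p i| -
        ∑ I ∈ P.1.parts, (∑ i ∈ I, q i - ∑ i ∈ I, p i) := by
    rw [Finset.sum_filter, Finset.mul_sum, ← Finset.sum_sub_distrib]
    refine Finset.sum_congr rfl fun I _ => ?_
    split_ifs with hI
    · rw [abs_of_neg (by linarith)]
      ring
    · rw [abs_of_nonneg (by linarith)]
      ring
  linarith

theorem exists_identity_test (hk : 0 < k) (hn : 0 < n) {ε : ℝ} (hε : 0 < ε) (hε2 : ε ≤ 2) {m : ℕ}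
    (hm : 2 ^ 20 * (Real.sqrt k / ε ^ 2) ≤ m) {p : Fin n → ℝ} (hp : p ∈ stdSimplex ℝ (Fin n)) :
    ∃ t : (Fin (m + m) → Fin n) → ℝ, (∀ x, 0 ≤ t x ∧ t x ≤ 1) ∧ 2 / 3 ≤ iidExp (m + m) p t ∧
      ∀ q ∈ stdSimplex ℝ (Fin n), ε / 2 ≤ akDist k q p →
        2 / 3 ≤ iidExp (m + m) q fun x => 1 - t x := by
  have hk' : (0 : ℝ) < k := by exact_mod_cast hk
  have hn' : (0 : ℝ) < n := by exact_mod_cast hn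
  have hsk : 0 < Real.sqrt k := Real.sqrt_pos.2 hk'
  have hm' : (0 : ℝ) < m := lt_of_lt_of_le (by positivity) hm
  have hm0 : 0 < m := by exact_mod_cast hm'
  -- Thus `16 / ε < 16 ^ J ≤ 256 / ε`: the lower bound makes the coupling loss at most `ε / 16`, the
  -- upper one keeps `4 ^ J * ε` bounded.
  obtain ⟨J₀, hJ1, hJ2⟩ := exists_nat_pow_near (x := 16 / ε) (y := 16)
    (by rw [le_div_iff₀ hε]; linarith) (by norm_num)
  set J := J₀ + 1 with hJ
  have hJlow : 1 / (16 : ℝ) ^ J ≤ ε / 16 := by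
    rw [div_lt_iff₀ hε] at hJ2
    rw [div_le_iff₀ (by positivity)]
    linarith
  have hJup : (4 : ℝ) ^ J * ε ≤ 256 := by
    have h4 : (4 : ℝ) ^ J ≤ 16 ^ J := pow_le_pow_left₀ (by norm_num) (by norm_num) _
    rw [le_div_iff₀ hε] at hJ1
    rw [hJ, pow_succ (16 : ℝ), ← hJ] at h4
    nlinarith
  -- The surviving deficit `ε / 16` gives energy at least `(ε / 16) ^ 2 / 32`.
  set θ₀ : ℝ := ε ^ 2 / 8192 with hθ₀
  have hθ₀p : 0 < θ₀ := by positivity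
  have hmθ : 2 ^ 7 * Real.sqrt k ≤ m * θ₀ := by
    calc 2 ^ 7 * Real.sqrt k = 2 ^ 20 * (Real.sqrt k / ε ^ 2) * θ₀ := by
          rw [hθ₀]; field_simp; norm_num
      _ ≤ _ := by gcongr
  have hmθ2 : 2 ^ 14 * (k : ℝ) ≤ (m * θ₀) ^ 2 := by
    have := pow_le_pow_left₀ (by positivity) hmθ 2
    rw [mul_pow, Real.sq_sqrt hk'.le] at this
    linarith
  have h1 : 4 * k ≤ ((m : ℝ) * θ₀) ^ 2 / 2048 := by linarith
  have h2 : 2 * k * 4 ^ J ≤ (m : ℝ) ^ 2 * θ₀ / 2048 := by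
    refine le_of_mul_le_mul_right ?_ hθ₀p
    have e : 2 * k * 4 ^ J * θ₀ = (4 ^ J * ε) * (ε * k / 4096) := by rw [hθ₀]; ring
    have i1 : (4 : ℝ) ^ J * ε * (ε * k / 4096) ≤ 256 * (ε * k / 4096) := by gcongr
    nlinarith
  set pb : Fin n → ℝ := fun i => (p i + 1 / n) / 2 with hpb
  have mix : ∀ q : Fin n → ℝ, ∑ i, q i = 1 → ∑ i, (q i + 1 / n) / 2 = 1 := fun q hq => by
    rw [← Finset.sum_div, Finset.sum_add_distrib, hq, Finset.sum_const, Finset.card_univ,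
      Fintype.card_fin, nsmul_eq_mul, mul_one_div_cancel hn'.ne']
    norm_num
  have hpb0 : ∀ i, 0 < pb i := fun i => by
    have := hp.1 i
    positivity
  obtain ⟨κ, hκ, hκ1, hκp, hst⟩ := exists_staircase_kernel (L := k * 16 ^ J) hpb0 (mix p hp.2)
    (by positivity)
  push_cast at hκp
  -- With probability `1 / 2` the sample is replaced by a uniform point of `[n]`, then `κ` is
  -- applied; this simulates samples from the mixture without knowing `q`.
  set K : Fin n → Fin (k * 16 ^ J) → ℝ := fun i a => (κ i a + ∑ i', 1 / n * κ i' a) / 2 with hK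
  have hK0 : ∀ i a, 0 ≤ K i a := fun i a =>
    div_nonneg (add_nonneg (hκ i a) (Finset.sum_nonneg fun i' _ =>
      mul_nonneg (by positivity) (hκ i' a))) zero_le_two
  have hK1 : ∀ i, ∑ a, K i a = 1 := fun i => by
    simp only [hK]
    rw [← Finset.sum_div, Finset.sum_add_distrib, hκ1, Finset.sum_comm]
    simp only [← Finset.mul_sum, hκ1, Finset.sum_const, Finset.card_univ, Fintype.card_fin,
      nsmul_eq_mul, mul_one]
    rw [mul_one_div_cancel hn'.ne']
    norm_num
  have push : ∀ q : Fin n → ℝ, ∑ i, q i = 1 → ∀ a,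
      ∑ i, q i * K i a = ∑ i, (q i + 1 / n) / 2 * κ i a := fun q hq a => by
    have e1 : ∀ i, q i * K i a = q i * κ i a / 2 + q i * ((∑ i', 1 / n * κ i' a) / 2) :=
      fun i => by simp only [hK]; ring
    have e2 : ∀ i, (q i + 1 / n) / 2 * κ i a = q i * κ i a / 2 + 1 / n * κ i a / 2 :=
      fun i => by ring
    simp only [e1, e2, Finset.sum_add_distrib, ← Finset.sum_mul, hq, one_mul, Finset.sum_div]
  set acc : (Fin (m + m) → Fin (k * 16 ^ J)) → ℝ := fun y =>
    if crossStat (gridKernel k J) y < (m : ℝ) ^ 2 * θ₀ / 2 then 1 else 0 with hacc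
  have acc01 : ∀ y, 0 ≤ acc y ∧ acc y ≤ 1 := fun y => by
    simp only [hacc]
    split_ifs <;> norm_num
  have hw : ∀ (x : Fin (m + m) → Fin n) (y : Fin (m + m) → Fin (k * 16 ^ J)),
      0 ≤ ∏ j, K (x j) (y j) := fun x y => Finset.prod_nonneg fun j _ => hK0 _ _
  refine ⟨fun x => ∑ y : Fin (m + m) → Fin (k * 16 ^ J), (∏ j, K (x j) (y j)) * acc y,
    fun x => ⟨?_, ?_⟩, ?_, fun q hq hqp => ?_⟩
  · exact Finset.sum_nonneg fun y _ => mul_nonneg (hw x y) (acc01 y).1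
  · rw [← sum_prod_kernel hK1 x]
    exact Finset.sum_le_sum fun y _ => mul_le_of_le_one_right (hw x y) (acc01 y).2
  · rw [iidExp_kernel]
    simp only [push p hp.2]
    simp only [hpb] at hκp
    simp only [hκp]
    exact iidExp_accept_uniform hk hm0 hθ₀p h1
  · have e : ∀ x : Fin (m + m) → Fin n,
        1 - ∑ y : Fin (m + m) → Fin (k * 16 ^ J), (∏ j, K (x j) (y j)) * acc y =
        ∑ y : Fin (m + m) → Fin (k * 16 ^ J), (∏ j, K (x j) (y j)) * (1 - acc y) := fun x => by
      simp only [mul_sub, mul_one, Finset.sum_sub_distrib, sum_prod_kernel hK1 x]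
    simp only [e]
    rw [iidExp_kernel]
    refine iidExp_reject_far hk hm0 hθ₀p
      (fun a => Finset.sum_nonneg fun i _ => mul_nonneg (hq.1 i) (hK0 i a)) ?_ ?_ h1 h2
    · rw [Finset.sum_comm]
      simp only [← Finset.mul_sum, hK1, mul_one, hq.2]
    -- The gap shrinks from `ε / 2` to `ε / 4` on deficient parts, to `ε / 8` by mixing, and to at
    -- least `ε / 16` by the coupling loss.
    · obtain ⟨P, 𝒜, h𝒜, hdef⟩ := exists_deficient_parts (k := k) hp.2 hq.2 (δ := ε / 4) (by positivity)
        (by linarith)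
      simp only [push q hq.2]
      have key := exists_grid_deficit (δ := ε / 8) hk P (p := pb)
        (q := fun i => (q i + 1 / n) / 2) (fun i => by have := hq.1 i; positivity) hκ hκ1 hκp
        (fun i => (hpb0 i).le) hst h𝒜 (by
          have : ∀ I ∈ 𝒜, ∑ i ∈ I, pb i - ∑ i ∈ I, (q i + 1 / n) / 2 =
              1 / 2 * (∑ i ∈ I, p i - ∑ i ∈ I, q i) := fun I _ => by
            rw [← Finset.sum_sub_distrib, ← Finset.sum_sub_distrib, Finset.mul_sum]
            exact Finset.sum_congr rfl fun i _ => by simp only [hpb]; ring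
          rw [Finset.sum_congr rfl this, ← Finset.mul_sum]
          linarith) (by linarith)
      have : (ε / 16) ^ 2 ≤ (ε / 8 - 1 / 16 ^ J) ^ 2 :=
        pow_le_pow_left₀ (by positivity) (by linarith) 2
      rw [hθ₀]
      linarith

end IdentityTest

/-! ### The tester for the class. -/

theorem l1Dist_le_two {n : ℕ} {p q : Fin n → ℝ} (hp : p ∈ stdSimplex ℝ (Fin n))
    (hq : q ∈ stdSimplex ℝ (Fin n)) : l1Dist q p ≤ 2 := by
  calc l1Dist q p ≤ ∑ i, (q i + p i) := Finset.sum_le_sum fun i _ =>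
        (abs_sub _ _).trans_eq (by rw [abs_of_nonneg (hq.1 i), abs_of_nonneg (hp.1 i)])
    _ = 2 := by
        rw [Finset.sum_add_distrib, hp.2, hq.2]
        norm_num

theorem proposition3 :
    ∃ c : ℝ, 0 < c ∧
      ∀ (n : ℕ) (C : Set (Fin n → ℝ)), C ⊆ stdSimplex ℝ (Fin n) →
      ∀ (ε : ℝ), 0 < ε →
      ∀ (k : ℕ),
        IsLeast {k : ℕ | 2 ≤ k ∧ k ≤ n ∧
          ∀ f₁ ∈ C, ∀ f₂ ∈ C, l1Dist f₁ f₂ ≤ akDist k f₁ f₂ + ε / 2} k →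
        ∃ (m : ℕ) (T : RandomizedTester n m),
          (m : ℝ) ≤ c * (Real.sqrt k / ε ^ 2) ∧ T.IsL1IdentityTester C ε := by
  classical
  refine ⟨2 ^ 22, by norm_num, fun n C hC ε hε k hk => ?_⟩
  obtain ⟨hk2, hkn, hkC⟩ := hk.1
  -- For `ε > 2` no pair of distributions is `ε`-far, so answering YES without samples works; the
  -- sample bound may be below 1 there.
  rcases lt_or_ge 2 ε with hε2 | hε2
  · refine ⟨0, ⟨fun _ _ => 1, fun _ _ => zero_le_one, fun _ _ => le_rfl⟩, ?_, ?_⟩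
    · rw [Nat.cast_zero]
      positivity
    · refine fun p hp q hq => ⟨fun _ => ?_, fun h => ?_⟩
      · simp only [RandomizedTester.probYes, Finset.univ_eq_empty, Finset.prod_empty, mul_one,
          Finset.sum_const, Finset.card_univ, Fintype.card_unique, one_smul]
        norm_num
      · have := l1Dist_le_two (hC hp) (hC hq)
        linarith
  have hsk : 1 ≤ Real.sqrt k := Real.one_le_sqrt.2 (by exact_mod_cast (by omega : 1 ≤ k))
  -- This lower bound absorbs the rounding of `m`, so that `2 * m` stays below `2 ^ 22 * (√k / ε ^
  -- 2)`.
  have hbase : 1 / 4 ≤ Real.sqrt k / ε ^ 2 := by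
    rw [le_div_iff₀ (by positivity)]
    nlinarith
  set m := ⌈2 ^ 20 * (Real.sqrt k / ε ^ 2)⌉₊ with hm
  have hmle : 2 ^ 20 * (Real.sqrt k / ε ^ 2) ≤ m := Nat.le_ceil _
  have hmlt : (m : ℝ) < 2 ^ 20 * (Real.sqrt k / ε ^ 2) + 1 := Nat.ceil_lt_add_one (by positivity)
  have ht := fun p : stdSimplex ℝ (Fin n) => exists_identity_test (k := k) (by omega)
    (by omega) hε hε2 hmle p.2
  choose t ht01 htp htq using ht
  refine ⟨m + m, ⟨fun p x => if hp : p ∈ stdSimplex ℝ (Fin n) then t ⟨p, hp⟩ x else 0,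
    fun p x => ?_, fun p x => ?_⟩, ?_, ?_⟩
  · split_ifs with hp
    exacts [(ht01 ⟨p, hp⟩ x).1, le_rfl]
  · split_ifs with hp
    exacts [(ht01 ⟨p, hp⟩ x).2, zero_le_one]
  · push_cast
    linarith
  · refine fun p hp q hq => ⟨?_, fun h => ?_⟩
    · rintro rfl
      simp only [RandomizedTester.probYes, dif_pos (hC hp)]
      exact htp ⟨q, hC hp⟩
    · simp only [RandomizedTester.probNo, dif_pos (hC hp)]
      refine htq ⟨p, hC hp⟩ q (hC hq) ?_
      have := hkC q hq p hp
      linarith
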